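/- Let $F$ be a finite field, let $m\ge 3$ be an integer, and let $C\subseteq F^n$ be an $[n,k,d]$ linear code over $F$, i.e. a linear subspace of dimension $k$ in which the least Hamming distance between two different codewords is $d$. Suppose that $\left(\frac{d-1}{n}\right)^m\ge\frac78$. For $j\ge 1$ let $C^j\subseteq F^{[n]^j}$ be the $j$-fold tensor power of $C$, i.e. the linear span of the words $(i_1,\dots,i_j)\mapsto x_1(i_1)\cdots x_j(i_j)$ with $x_1,\dots,x_j\in C$. For a word $r$ and a code $D$ on the same coordinates, let $\delta_D(r)$ be the minimum over $x\in D$ of the fraction of coordinates in which $r$ and $x$ differ. For $r\in F^{[n]^m}$, $b\in[m]$ and $i\in[n]$ let $r_{b,i}\in F^{[n]^{m-1}}$ be the restriction of $r$ to the hyperplane on which the $b$-th coordinate equals $i$: $r_{b,i}[i_1,\dots,i_{m-1}]=r[i_1,\dots,i_{b-1},i,i_b,\dots,i_{m-1}]$. The $m$-Product Tester picks $b\in[m]$ and $i\in[n]$ independently and uniformly at random, reads $r_{b,i}$, and accepts if and only if $r_{b,i}\in C^{m-1}$. Then the $m$-Product Tester is $2^{-16}$-robust for $C^m$: every $r\in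 C^m$ is accepted with probability one, and for every $r\in F^{[n]^m}$, $$\mathbb E_{b,i}\left[\delta_{C^{m-1}}(r_{b,i})\right]\;\ge\;2^{-16}\cdot\delta_{C^m}(r).$$ -/

import Mathlib

namespace ProductCode

/-- The relative Hamming distance between two words indexed by `ι`: the fraction of
coordinates in which they differ. -/
noncomputable def relDist {ι F : Type*} [Fintype ι] [DecidableEq F] (x y : ι → F) : ℝ :=
  (hammingDist x y : ℝ) / (Fintype.card ι : ℝ)

/-- The relative distance of a word `r` to a nonempty set of words `C`, that is, the minimum of
`relDist r x` over `x ∈ C` (for finite `ι` the infimum is attained, as `relDist` takes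
finitely many values). -/
noncomputable def relDistTo {ι F : Type*} [Fintype ι] [DecidableEq F]
    (C : Set (ι → F)) (r : ι → F) : ℝ :=
  sInf ((fun x => relDist r x) '' C)

/-- `C` is an `[n, k, d]` code over `F`: a linear subspace of `F ^ n` of dimension `k` whose
minimum distance (the least Hamming distance of two different codewords) is `d`. -/
structure IsLinearCode {F : Type*} [Field F] [DecidableEq F] {n : ℕ}
    (C : Submodule F (Fin n → F)) (k d : ℕ) : Prop where
  finrank_eq : Module.finrank F C = k
  isLeast_dist : IsLeast {e : ℕ | ∃ x ∈ C, ∃ y ∈ C, x ≠ y ∧ hammingDist x y = e} d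

/-- The pure tensor `x₁ ⊗ ⋯ ⊗ xₘ`, as a word indexed by `[n] ^ m`. -/
def pureTensor {F : Type*} [Field F] {m n : ℕ} (x : Fin m → (Fin n → F)) :
    (Fin m → Fin n) → F :=
  fun p => ∏ b, x b (p b)

/-- The tensor power `C ^ m = C ⊗ ⋯ ⊗ C` (`m` factors), as a linear code of words indexed by
`[n] ^ m`: the span of the pure tensors of codewords of `C`. -/
def tensorPower {F : Type*} [Field F] {n : ℕ} (C : Submodule F (Fin n → F)) (m : ℕ) :
    Submodule F ((Fin m → Fin n) → F) :=
  Submodule.span F {w | ∃ x : Fin m → (Fin n → F), (∀ b, x b ∈ C) ∧ w = pureTensor x}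

/-- The description of `C ^ m` by a generator matrix `M` of `C`: its codewords are the words
obtained from an array `X` of format `k × ⋯ × k` by applying `M` along every axis. For `m = 2`
these are the matrices `Mᵀ X M`. -/
theorem mem_tensorPower_iff {F : Type*} [Field F] {n k : ℕ} (C : Submodule F (Fin n → F))
    (M : Matrix (Fin k) (Fin n) F) (hM : ∀ w, w ∈ C ↔ ∃ a : Fin k → F, Matrix.vecMul a M = w)
    (m : ℕ) (w : (Fin m → Fin n) → F) :
    w ∈ tensorPower C m ↔
      ∃ X : (Fin m → Fin k) → F, w = fun p => ∑ j, X j * ∏ b, M (j b) (p b) := by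
  constructor
  · intro h
    induction h using Submodule.span_induction with
    | mem w hw =>
      obtain ⟨x, hx, rfl⟩ := hw
      choose a ha using fun b => (hM (x b)).1 (hx b)
      refine ⟨fun j => ∏ b, a b (j b), funext fun p => ?_⟩
      simp only [pureTensor, ← ha, Matrix.vecMul, dotProduct, Finset.prod_univ_sum,
        Fintype.piFinset_univ, Finset.prod_mul_distrib]
    | zero => exact ⟨0, by ext; simp⟩
    | add u v _ _ hu hv =>
      obtain ⟨X, rfl⟩ := hu
      obtain ⟨Y, rfl⟩ := hv
      exact ⟨X + Y, by ext; simp [add_mul, Finset.sum_add_distrib]⟩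
    | smul c u _ hu =>
      obtain ⟨X, rfl⟩ := hu
      exact ⟨c • X, by ext; simp [Finset.mul_sum, mul_assoc]⟩
  · rintro ⟨X, rfl⟩
    have : (fun p : Fin m → Fin n => ∑ j, X j * ∏ b, M (j b) (p b)) =
        ∑ j : Fin m → Fin k, X j • pureTensor (fun b => M (j b)) := by
      ext p; simp [pureTensor]
    rw [this]
    refine Submodule.sum_mem _ fun j _ => Submodule.smul_mem _ _ (Submodule.subset_span ?_)
    exact ⟨_, fun b => (hM _).2 ⟨Pi.single (j b) 1, by simp [Matrix.row]⟩, rfl⟩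

/-- A non-adaptive tester of words `r : ι → F`. On the random seed `s : S` (drawn uniformly) it
reads the entries of `r` at the positions `query s q` for `q : Q` (so that it makes `|Q|`
queries) and accepts iff the view lies in `accepting s`. -/
structure Tester (S Q ι F : Type*) where
  query : S → Q → ι
  accepting : S → Set (Q → F)

namespace Tester

variable {S Q ι F : Type*}

/-- What the tester reads of the oracle `r` on the seed `s`. -/
def view (T : Tester S Q ι F) (r : ι → F) (s : S) : Q → F :=
  fun q => r (T.query s q)

/-- The tester accepts the oracle `r` on the seed `s`. -/
def Accepts (T : Tester S Q ι F) (r : ι → F) (s : S) : Prop :=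
  T.view r s ∈ T.accepting s

/-- The robustness of the tester on `r` and `s`: the relative distance of its view to the set
of accepted views. -/
noncomputable def robustness [Fintype Q] [DecidableEq F] (T : Tester S Q ι F)
    (r : ι → F) (s : S) : ℝ :=
  relDistTo (T.accepting s) (T.view r s)

/-- The expected robustness of the tester on `r`, over a uniformly random seed. -/
noncomputable def expectedRobustness [Fintype S] [Fintype Q] [DecidableEq F]
    (T : Tester S Q ι F) (r : ι → F) : ℝ :=
  (∑ s, T.robustness r s) / (Fintype.card S : ℝ)

/-- `T` is an `α`-robust tester for the code `C`: codewords are accepted with probability one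
(on every seed, as the seed is uniform on a finite set), and for every word the expected
robustness is at least `α` times the relative distance of the word to `C`. -/
def IsRobust [Fintype S] [Fintype Q] [Fintype ι] [DecidableEq F]
    (T : Tester S Q ι F) (α : ℝ) (C : Set (ι → F)) : Prop :=
  (∀ r ∈ C, ∀ s, T.Accepts r s) ∧
    ∀ r : ι → F, α * relDistTo C r ≤ T.expectedRobustness r

end Tester

/-- The point `(p₁, …, p_{b-1}, i, p_b, …, p_{m-1})` of the hyperplane of `[n] ^ m` on which the
`b`-th coordinate is `i`. -/
def planePoint {n : ℕ} : (m : ℕ) → Fin m → Fin n → (Fin (m - 1) → Fin n) → (Fin m → Fin n)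
  | 0, b, _, _ => b.elim0
  | _ + 1, b, i, p => Fin.insertNth (α := fun _ => Fin n) b i p

/-- The `m`-Product Tester: on the seed `(b, i) ∈ [m] × [n]` it reads the restriction `r_{b,i}`
of `r` to the points whose `b`-th coordinate is `i`, and accepts iff `r_{b,i} ∈ C ^ (m - 1)`. -/
def productTester {F : Type*} [Field F] {n : ℕ} (C : Submodule F (Fin n → F)) (m : ℕ) :
    Tester (Fin m × Fin n) (Fin (m - 1) → Fin n) (Fin m → Fin n) F where
  query s p := planePoint m s.1 s.2 p
  accepting _ := (tensorPower C (m - 1) : Set ((Fin (m - 1) → Fin n) → F))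

end ProductCode

namespace ProductCode

open Finset Function

variable {F : Type*} [Field F] {n m : ℕ}

/-! Give each plane `u` the tensor codeword `c u` nearest to the restriction of `r`, and let `T` be
the total number of disagreements, so the expected robustness is `T / (m * n ^ m)`. It suffices to
find a tensor codeword `w` with `m * hammingDist r w ≤ 2 ^ 16 * T`.

Consider the graph of planes whose words differ somewhere on their intersection. Such a difference
spreads along every other direction, so the degrees of adjacent planes add up to at least `(m - 2) *
d` (`Inconsistent.le_card_add_card`), and the planes of at least half that degree form a vertex
cover `H`. An edge also forces `d ^ (m - 2)` disagreements with `r`, so there are few edges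
(`sum_card_inconsistentWith_mul_le`) and `H` is small.

Unless `T` is so large that `w = 0` works, most directions have fewer than `d` planes in `H`. The
remaining planes there carry mutually consistent words and still determine codewords, so the words
glue to one `w` (`exists_mem_tensorPower_eq_on_planes`). Slicing along each such direction and
summing bounds the distance from `r` to `w`. -/

/-! ### Tensor codewords through lines, and interpolation from boxes. -/

/-- Every line of `w` in direction `b` is a codeword of `C`. -/
def LineIn (C : Submodule F (Fin n → F)) (b : Fin m) (w : (Fin m → Fin n) → F) : Prop :=
  ∀ p : Fin m → Fin n, (fun i => w (update p b i)) ∈ C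

theorem LineIn.sub {C : Submodule F (Fin n → F)} {b : Fin m} {v w : (Fin m → Fin n) → F}
    (hv : LineIn C b v) (hw : LineIn C b w) : LineIn C b (v - w) :=
  fun p => C.sub_mem (hv p) (hw p)

theorem lineIn_of_mem_tensorPower {C : Submodule F (Fin n → F)} {w : (Fin m → Fin n) → F}
    (hw : w ∈ tensorPower C m) (b : Fin m) : LineIn C b w := by
  intro p
  induction hw using Submodule.span_induction with
  | mem w hw =>
    obtain ⟨x, hx, rfl⟩ := hw
    have : (fun i => pureTensor x (update p b i)) =
        (∏ a ∈ univ.erase b, x a (p a)) • x b := by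
      ext i
      simp only [pureTensor, Pi.smul_apply, smul_eq_mul]
      rw [← mul_prod_erase _ _ (mem_univ b), update_self, mul_comm]
      congr 1
      refine prod_congr rfl fun a ha => ?_
      rw [update_of_ne (ne_of_mem_erase ha)]
    rw [this]
    exact C.smul_mem _ (hx b)
  | zero => exact C.zero_mem
  | add u v _ _ hu hv => exact C.add_mem hu hv
  | smul c u _ hu => exact C.smul_mem c hu

/-- Applying along each axis an operator that fixes the lines of `g` inside a box fixes `g` on
that box. -/
theorem sum_prod_mul_eq_of_lines : ∀ {m : ℕ} (A : Fin m → Fin n → Fin n → F)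
    (S : Fin m → Finset (Fin n)) (g : (Fin m → Fin n) → F),
    (∀ b i j, j ∉ S b → A b i j = 0) →
    (∀ b p, (∀ a, p a ∈ S a) → ∑ j, A b (p b) j * g (update p b j) = g p) →
    ∀ p, (∀ a, p a ∈ S a) → ∑ q : Fin m → Fin n, (∏ b, A b (p b) (q b)) * g q = g p
  | 0, A, S, g, _, _, p, _ => by
    simp [Subsingleton.elim default p]
  | m + 1, A, S, g, hA, hg, p, hp => by
    rw [← (Fin.consEquiv fun _ => Fin n).sum_comp, Fintype.sum_prod_type]
    have key : ∀ i ∈ S 0, ∑ q : Fin m → Fin n, (∏ b, A b.succ (p b.succ) (q b)) *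
        g (Fin.cons i q) = g (Fin.cons i fun b => p b.succ) := by
      intro i hi
      refine sum_prod_mul_eq_of_lines (fun b => A b.succ) (fun b => S b.succ)
        (fun q => g (Fin.cons i q)) (fun b => hA b.succ) ?_ (fun b => p b.succ)
        fun b => hp b.succ
      intro b q hq
      have := hg b.succ (Fin.cons i q : Fin (m + 1) → Fin n) (Fin.cases hi hq)
      simpa [Fin.cons_update] using this
    rw [← hg 0 p hp]
    refine sum_congr rfl fun i _ => ?_
    have hu : update p 0 i = (Fin.cons i fun b => p b.succ : Fin (m + 1) → Fin n) := by
      ext b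
      refine Fin.cases ?_ (fun b => ?_) b
      · simp
      · simp [Fin.succ_ne_zero]
    by_cases hi : i ∈ S 0
    · rw [hu, ← key i hi, mul_sum]
      refine sum_congr rfl fun q _ => ?_
      simp [Fin.consEquiv, Fin.prod_univ_succ, mul_assoc]
    -- Off the box the operator entry is zero, so nothing need be known about `g` there.
    · simp [Fin.consEquiv, Fin.prod_univ_succ, hA 0 (p 0) i hi]

/-- If a codeword of `C` is determined by its entries in `S`, then there is a linear operator
that recovers codewords from these entries and takes values in `C`. -/
theorem exists_reconstruction (C : Submodule F (Fin n → F)) (S : Finset (Fin n))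
    (hS : ∀ x ∈ C, (∀ i ∈ S, x i = 0) → x = 0) :
    ∃ A : Fin n → Fin n → F, (∀ j, (fun i => A i j) ∈ C) ∧ (∀ i, ∀ j ∉ S, A i j = 0) ∧
      ∀ x ∈ C, ∀ i, ∑ j, A i j * x j = x i := by
  let R : C →ₗ[F] (S → F) := (LinearMap.funLeft F F (Subtype.val : S → Fin n)).comp C.subtype
  have hR : LinearMap.ker R = ⊥ := by
    rw [LinearMap.ker_eq_bot']
    intro x hx
    exact Subtype.ext (hS x x.2 fun i hi => congrFun hx ⟨i, hi⟩)
  obtain ⟨L, hL⟩ := R.exists_leftInverse_of_injective hR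
  -- Column `j` is the image of the `j`-th unit vector under a left inverse `L` of restriction to
  -- `S`.
  refine ⟨fun i j => if h : j ∈ S then (L (Pi.single ⟨j, h⟩ 1) : Fin n → F) i else 0,
    fun j => ?_, fun i j hj => dif_neg hj, fun x hx i => ?_⟩
  · by_cases h : j ∈ S
    · simp [h]
    · simp only [h, dite_false]
      exact C.zero_mem
  · have hLx : L (R ⟨x, hx⟩) = ⟨x, hx⟩ := LinearMap.congr_fun hL ⟨x, hx⟩
    have hsum : R ⟨x, hx⟩ = ∑ j : S, x j • (Pi.single j 1 : S → F) := by
      ext k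
      simp [R, LinearMap.funLeft_apply, Finset.sum_apply, Pi.single_apply]
    rw [hsum, map_sum] at hLx
    have hi := congrFun (congrArg Subtype.val hLx) i
    simp only [map_smul, AddSubmonoidClass.coe_finsetSum, Submodule.coe_smul,
      Finset.sum_apply, Pi.smul_apply, smul_eq_mul] at hi
    rw [← sum_subset (subset_univ S) (fun j _ hj => by simp [hj]), ← sum_coe_sort S]
    rw [← hi]
    exact sum_congr rfl fun j _ => by simp [mul_comm]

theorem sum_smul_pureTensor_mem {C : Submodule F (Fin n → F)} (A : Fin m → Fin n → Fin n → F)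
    (hA : ∀ b j, (fun i => A b i j) ∈ C) (g : (Fin m → Fin n) → F) :
    (fun p : Fin m → Fin n => ∑ q : Fin m → Fin n, (∏ b, A b (p b) (q b)) * g q) ∈
      tensorPower C m := by
  have : (fun p : Fin m → Fin n => ∑ q : Fin m → Fin n, (∏ b, A b (p b) (q b)) * g q) =
      ∑ q : Fin m → Fin n, g q • pureTensor fun b i => A b i (q b) := by
    ext p
    simp [pureTensor, mul_comm]
  rw [this]
  exact Submodule.sum_mem _ fun q _ => Submodule.smul_mem _ _
    (Submodule.subset_span ⟨_, fun b => hA b (q b), rfl⟩)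

/-- The tensor power consists of the words all of whose axis-parallel lines are codewords. -/
theorem mem_tensorPower_iff_lineIn {C : Submodule F (Fin n → F)} {w : (Fin m → Fin n) → F} :
    w ∈ tensorPower C m ↔ ∀ b, LineIn C b w := by
  refine ⟨lineIn_of_mem_tensorPower, fun hw => ?_⟩
  -- With `S = univ` the operator is a projection onto `C`.
  obtain ⟨A, hAC, hA0, hA⟩ := exists_reconstruction C univ fun x _ h => funext fun i =>
    h i (mem_univ i)
  have := sum_smul_pureTensor_mem (fun _ : Fin m => A) (fun _ => hAC) w
  convert this using 1
  ext p
  refine (sum_prod_mul_eq_of_lines (fun _ => A) (fun _ => univ) w (fun _ => hA0) ?_ p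
    fun _ => mem_univ _).symm
  intro b p _
  simpa using hA _ (hw b p) (p b)

/-- Gluing: a word on a box whose lines extend to codewords extends to a tensor codeword, provided
that each side of the box determines codewords. -/
theorem exists_mem_tensorPower_eq_on_box (C : Submodule F (Fin n → F))
    (S : Fin m → Finset (Fin n)) (hS : ∀ b, ∀ x ∈ C, (∀ i ∈ S b, x i = 0) → x = 0)
    (g : (Fin m → Fin n) → F)
    (hg : ∀ b p, (∀ a, p a ∈ S a) → ∃ x ∈ C, ∀ j ∈ S b, g (update p b j) = x j) :
    ∃ w ∈ tensorPower C m, ∀ p, (∀ a, p a ∈ S a) → w p = g p := by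
  choose A hAC hA0 hA using fun b => exists_reconstruction C (S b) (hS b)
  refine ⟨_, sum_smul_pureTensor_mem A hAC g, sum_prod_mul_eq_of_lines A S g hA0 ?_⟩
  intro b p hp
  obtain ⟨x, hx, hxg⟩ := hg b p hp
  have h1 : g p = x (p b) := by simpa using hxg (p b) (hp b)
  rw [h1, ← hA b x hx (p b)]
  refine sum_congr rfl fun j _ => ?_
  by_cases hj : j ∈ S b
  · rw [hxg j hj]
  · rw [hA0 b _ j hj, zero_mul, zero_mul]

/-- Vanishing propagates from the box one direction of `J` at a time, since a line vanishing on `S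
b` is zero. Coordinates outside `J` stay fixed, so this can be used inside a single plane. -/
theorem eq_zero_of_eq_zero_on_box {C : Submodule F (Fin n → F)} {S : Fin m → Finset (Fin n)}
    (hS : ∀ b, ∀ x ∈ C, (∀ i ∈ S b, x i = 0) → x = 0) {w : (Fin m → Fin n) → F}
    (J : Finset (Fin m)) (hw : ∀ b ∈ J, LineIn C b w) (p₀ : Fin m → Fin n)
    (h₀ : ∀ p, (∀ b ∉ J, p b = p₀ b) → (∀ b ∈ J, p b ∈ S b) → w p = 0) : w p₀ = 0 := by
  induction J using Finset.induction_on generalizing p₀ with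
  | empty => exact h₀ p₀ (fun _ _ => rfl) (by simp)
  | insert b J hb ih =>
    have := hS b _ (hw b (mem_insert_self b J) p₀) fun i hi => by
      refine ih (fun a ha => hw a (mem_insert_of_mem ha)) _ fun p hp hpS => h₀ p ?_ ?_
      · intro a ha
        rw [mem_insert, not_or] at ha
        rw [hp a ha.2, update_of_ne ha.1]
      · intro a ha
        rcases mem_insert.1 ha with rfl | ha
        · rw [hp a hb, update_self]
          exact hi
        · exact hpS a ha
    simpa using congrFun this (p₀ b)

/-- Extending a tensor codeword on a plane constantly along the normal direction preserves its
lines. -/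
theorem lineIn_comp_removeNth {C : Submodule F (Fin n → F)} {x : (Fin m → Fin n) → F}
    (hx : x ∈ tensorPower C m) {a b : Fin (m + 1)} (hab : a ≠ b) :
    LineIn C a (fun p => x (b.removeNth p)) := by
  obtain ⟨a, rfl⟩ := Fin.exists_succAbove_eq hab
  intro p
  have := lineIn_of_mem_tensorPower hx a (b.removeNth p)
  convert this using 3 with i
  ext e
  by_cases he : e = a
  · subst he
    simp [Fin.removeNth]
  · simp [Fin.removeNth, he]

theorem insertNth_mem_tensorPower {C : Submodule F (Fin n → F)} {w : (Fin (m + 1) → Fin n) → F}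
    (hw : w ∈ tensorPower C (m + 1)) (b : Fin (m + 1)) (i : Fin n) :
    (fun p => w (Fin.insertNth (α := fun _ => Fin n) b i p)) ∈ tensorPower C m := by
  rw [mem_tensorPower_iff_lineIn]
  intro a p
  have := lineIn_of_mem_tensorPower hw (b.succAbove a) (Fin.insertNth (α := fun _ => Fin n) b i p)
  convert this using 3 with j
  rw [Fin.insertNth_update]

variable [DecidableEq F]

/-! ### Weights of tensor words. -/

/-- A word which is nonzero at `p₀` and has codewords of weight at least `d` as lines in the
directions `J` has at least `d ^ |J|` nonzero entries in the subcube through `p₀`. -/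
theorem pow_card_le_card_ne_zero {C : Submodule F (Fin n → F)} {d : ℕ}
    (hd : ∀ x ∈ C, x ≠ 0 → d ≤ #{i | x i ≠ 0}) {w : (Fin m → Fin n) → F}
    (J : Finset (Fin m)) (hw : ∀ b ∈ J, LineIn C b w) (p₀ : Fin m → Fin n) (h₀ : w p₀ ≠ 0) :
    d ^ #J ≤ #{p | (∀ b ∉ J, p b = p₀ b) ∧ w p ≠ 0} := by
  induction J using Finset.induction_on generalizing p₀ with
  | empty =>
    rw [card_empty, pow_zero, Nat.one_le_iff_ne_zero, card_ne_zero]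
    exact ⟨p₀, by simp [h₀]⟩
  | insert b J hb ih =>
    have hline := hd _ (hw b (mem_insert_self b J) p₀) (fun h => h₀ (by
      simpa using congrFun h (p₀ b)))
    -- Each of the at least `d` values in `I` starts a disjoint subcube to which the induction
    -- hypothesis applies.
    set I : Finset (Fin n) := {i | w (update p₀ b i) ≠ 0} with hI
    have hsub : I.biUnion (fun i => ({p | (∀ a ∉ J, p a = update p₀ b i a) ∧ w p ≠ 0} :
        Finset (Fin m → Fin n))) ⊆ ({p | (∀ a ∉ insert b J, p a = p₀ a) ∧ w p ≠ 0} :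
        Finset (Fin m → Fin n)) := by
      intro p hp
      simp only [mem_biUnion, mem_filter, mem_univ, true_and] at hp ⊢
      obtain ⟨i, -, h1, h2⟩ := hp
      refine ⟨fun a ha => ?_, h2⟩
      rw [mem_insert, not_or] at ha
      rw [h1 a ha.2, update_of_ne ha.1]
    refine le_trans ?_ (card_le_card hsub)
    rw [card_biUnion, card_insert_of_notMem hb, pow_succ']
    · refine (Nat.mul_le_mul_right _ hline).trans ?_
      rw [← smul_eq_mul]
      refine card_nsmul_le_sum _ _ _ fun i hi => ?_
      exact ih (fun a ha => hw a (mem_insert_of_mem ha)) _ (mem_filter.1 hi).2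
    · intro i _ j _ hij
      rw [Function.onFun, disjoint_left]
      intro p hp hq
      have h1 := (mem_filter.1 hp).2.1 b hb
      have h2 := (mem_filter.1 hq).2.1 b hb
      rw [update_self] at h1 h2
      exact hij (h1.symm.trans h2)

/-! ### Gluing consistent plane words. -/

/-- The plane words assigned to `u` and `v` differ on the intersection of the two planes, where the
pair `(b, i)` stands for the plane on which the `b`-th coordinate is `i`. -/
def Inconsistent {α : Type*} (c : Fin m × Fin n → (Fin m → Fin n) → α) (u v : Fin m × Fin n) : Prop :=
  u.1 ≠ v.1 ∧ ∃ p : Fin m → Fin n, p u.1 = u.2 ∧ p v.1 = v.2 ∧ c u p ≠ c v p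

/-- Consistent plane words on sufficiently many planes in at least two directions are the
restrictions of one tensor codeword. -/
theorem exists_mem_tensorPower_eq_on_planes {C : Submodule F (Fin n → F)} {d : ℕ}
    (hd : ∀ x ∈ C, x ≠ 0 → d ≤ #{i | x i ≠ 0})
    {c : Fin m × Fin n → (Fin m → Fin n) → F} (hc : ∀ u, ∀ a ≠ u.1, LineIn C a (c u))
    (H : Finset (Fin m × Fin n)) (hH : ∀ u ∉ H, ∀ v ∉ H, ¬ Inconsistent c u v)
    (B : Finset (Fin m)) (hB : 1 < #B) (hBH : ∀ b ∈ B, #{i | (b, i) ∈ H} < d) :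
    ∃ w ∈ tensorPower C m, ∀ b ∈ B, ∀ p : Fin m → Fin n, (b, p b) ∉ H → w p = c (b, p b) p := by
  set S : Fin m → Finset (Fin n) := fun b => {i | b ∈ B → (b, i) ∉ H} with hSdef
  have memS : ∀ b i, i ∈ S b ↔ (b ∈ B → (b, i) ∉ H) := fun b i => by simp [hSdef]
  have hS : ∀ b, ∀ x ∈ C, (∀ i ∈ S b, x i = 0) → x = 0 := by
    intro b x hx h
    by_contra hx0
    have h1 := hd x hx hx0
    by_cases hb : b ∈ B
    · refine (h1.trans (card_le_card fun i hi => ?_)).not_gt (hBH b hb)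
      rw [mem_filter] at hi ⊢
      by_contra hi'
      exact hi.2 (h i ((memS b i).2 fun _ hiH => hi' ⟨mem_univ i, hiH⟩))
    · exact hx0 (funext fun i => h i ((memS b i).2 fun hb' => absurd hb' hb))
  obtain ⟨b₀, hb₀, b₁, hb₁, hne⟩ := one_lt_card.1 hB
  have agree : ∀ b ∈ B, ∀ b' ∈ B, ∀ p : Fin m → Fin n, (b, p b) ∉ H → (b', p b') ∉ H →
      c (b, p b) p = c (b', p b') p := by
    intro b _ b' _ p hp hp'
    by_contra h
    exact hH _ hp _ hp' ⟨fun hbb => h (by dsimp only at hbb; rw [hbb]), p, rfl, rfl, h⟩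
  obtain ⟨w, hw, hwg⟩ := exists_mem_tensorPower_eq_on_box C S hS
    (fun p => c (b₀, p b₀) p) (by
      intro a p hp
      -- A plane word has codeword lines only along the plane. For `a = b₀` the word of a second
      -- direction is needed, whence `1 < #B`.
      obtain ⟨b, hb, hba⟩ : ∃ b ∈ B, a ≠ b := by
        by_cases h : a = b₀
        · exact ⟨b₁, hb₁, h ▸ hne⟩
        · exact ⟨b₀, hb₀, h⟩
      refine ⟨_, hc (b, p b) a hba p, fun j hj => ?_⟩
      have hq : ∀ e, update p a j e ∈ S e := by
        intro e
        by_cases he : e = a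
        · subst he
          rwa [update_self]
        · rw [update_of_ne he]
          exact hp e
      have := agree b₀ hb₀ b hb (update p a j) ((memS _ _).1 (hq b₀) hb₀)
        ((memS _ _).1 (hq b) hb)
      rw [update_of_ne hba.symm] at this
      exact this)
  refine ⟨w, hw, fun b hb p hp => ?_⟩
  rw [← sub_eq_zero]
  -- Agreement on the box part of the plane extends to the whole plane.
  refine eq_zero_of_eq_zero_on_box hS (w := w - c (b, p b)) (univ.erase b)
    (fun a ha => (lineIn_of_mem_tensorPower hw a).sub (hc (b, p b) a (ne_of_mem_erase ha))) p ?_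
  intro q hq hqS
  have hqb : q b = p b := hq b (notMem_erase b _)
  have hqS' : ∀ a, q a ∈ S a := by
    intro a
    by_cases hab : a = b
    · subst hab
      rw [hqb]
      exact (memS _ _).2 fun _ => hp
    · exact hqS a (mem_erase.2 ⟨hab, mem_univ a⟩)
  rw [Pi.sub_apply, hwg q hqS', sub_eq_zero, ← hqb]
  exact agree b₀ hb₀ b hb q ((memS _ _).1 (hqS' b₀) hb₀) ((memS _ _).1 (hqS' b) hb)

/-! ### Counting inconsistent planes. -/

theorem card_filter_prod {α β : Type*} [Fintype α] [Fintype β] (P : α × β → Prop)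
    [DecidablePred P] : #{u : α × β | P u} = ∑ a, #{b | P (a, b)} := by
  simp only [card_filter, Fintype.sum_prod_type]

open scoped Classical in
/-- The set of planes inconsistent with `u`. -/
noncomputable def inconsistentWith {α : Type*} (c : Fin m × Fin n → (Fin m → Fin n) → α)
    (u : Fin m × Fin n) : Finset (Fin m × Fin n) :=
  {v | Inconsistent c u v}

theorem mem_inconsistentWith {α : Type*} {c : Fin m × Fin n → (Fin m → Fin n) → α} {u v : Fin m × Fin n} :
    v ∈ inconsistentWith c u ↔ Inconsistent c u v := by
  simp [inconsistentWith]

/-- The number of planes inconsistent with one of two inconsistent planes is large. -/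
theorem Inconsistent.le_card_add_card {C : Submodule F (Fin n → F)} {d : ℕ}
    (hd : ∀ x ∈ C, x ≠ 0 → d ≤ #{i | x i ≠ 0})
    {c : Fin m × Fin n → (Fin m → Fin n) → F} (hc : ∀ u, ∀ a ≠ u.1, LineIn C a (c u))
    {u v : Fin m × Fin n} (huv : Inconsistent c u v) :
    (m - 2) * d ≤ #(inconsistentWith c u) + #(inconsistentWith c v) := by
  obtain ⟨hne, p, hpu, hpv, hp⟩ := huv
  refine le_trans ?_ (card_union_le _ _)
  have h1 : #(inconsistentWith c u ∪ inconsistentWith c v) =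
      #{x | x ∈ inconsistentWith c u ∪ inconsistentWith c v} := by
    rw [filter_univ_mem]
  rw [h1, card_filter_prod]
  have hcard : #((univ.erase u.1).erase v.1 : Finset (Fin m)) = m - 2 := by
    rw [card_erase_of_mem (mem_erase.2 ⟨hne.symm, mem_univ _⟩), card_erase_of_mem (mem_univ _),
      card_univ, Fintype.card_fin]
    omega
  refine le_trans ?_ (sum_le_sum_of_subset (subset_univ ((univ.erase u.1).erase v.1)))
  rw [← hcard, ← smul_eq_mul]
  refine card_nsmul_le_sum _ _ _ fun a ha => ?_
  simp only [mem_erase, mem_univ, and_true] at ha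
  -- The line of `c u - c v` through `p` in direction `a` is a nonzero codeword. Where it is
  -- nonzero, the crossing plane `(a, i)` cannot agree with both.
  refine (hd _ (((hc u a ha.2).sub (hc v a ha.1)) p) fun h => hp ?_).trans
    (card_le_card fun i hi => ?_)
  · have := congrFun h (p a)
    simpa [sub_eq_zero] using this
  · simp only [mem_filter, mem_univ, true_and, mem_union, mem_inconsistentWith, Pi.sub_apply,
      sub_ne_zero] at hi ⊢
    by_cases h : c u (update p a i) = c (a, i) (update p a i)
    · refine Or.inr ⟨ha.1.symm, update p a i, ?_, update_self .., fun h' => hi (h.trans h'.symm)⟩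
      rw [update_of_ne ha.1.symm, hpv]
    · refine Or.inl ⟨ha.2.symm, update p a i, ?_, update_self .., h⟩
      rw [update_of_ne ha.2.symm, hpu]

/-- Double counting of the triples of two planes and a point in their intersection at which
the word of the first plane differs from `r`. -/
theorem sum_card_plane_inter_le {α : Type*} [DecidableEq α]
    (c : Fin m × Fin n → (Fin m → Fin n) → α) (r : (Fin m → Fin n) → α)
    (u : Fin m × Fin n) :
    ∑ v : Fin m × Fin n with u.1 ≠ v.1, #{p : Fin m → Fin n | p u.1 = u.2 ∧ p v.1 = v.2 ∧ r p ≠ c u p} ≤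
      (m - 1) * #{p : Fin m → Fin n | p u.1 = u.2 ∧ r p ≠ c u p} := by
  have h1 := sum_card_bipartiteAbove_eq_sum_card_bipartiteBelow
    (s := ({v | u.1 ≠ v.1} : Finset (Fin m × Fin n)))
    (t := ({p | p u.1 = u.2 ∧ r p ≠ c u p} : Finset (Fin m → Fin n)))
    (fun v p => p v.1 = v.2)
  have h2 : ∑ v : Fin m × Fin n with u.1 ≠ v.1, #{p : Fin m → Fin n | p u.1 = u.2 ∧ p v.1 = v.2 ∧ r p ≠ c u p} =
      ∑ v : Fin m × Fin n with u.1 ≠ v.1, #(bipartiteAbove (fun v p => p v.1 = v.2)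
        ({p | p u.1 = u.2 ∧ r p ≠ c u p} : Finset (Fin m → Fin n)) v) := by
    refine sum_congr rfl fun v _ => congrArg card ?_
    ext p
    simp only [bipartiteAbove, mem_filter, mem_univ, true_and]
    tauto
  rw [h2, h1, mul_comm, ← smul_eq_mul]
  -- Each `p` lies on exactly one plane in each of the `m - 1` other directions.
  refine sum_le_card_nsmul _ _ _ fun p _ => ?_
  have h3 : #(univ.erase u.1) = m - 1 := by
    rw [card_erase_of_mem (mem_univ _), card_univ, Fintype.card_fin]
  rw [← h3]
  refine card_le_card_of_injOn Prod.fst (fun v hv => ?_) fun v hv v' hv' h => ?_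
  · simp only [bipartiteBelow, coe_filter, mem_filter, mem_univ, true_and, Set.mem_ofPred_eq] at hv
    simpa using hv.1.symm
  · simp only [bipartiteBelow, coe_filter, mem_filter, mem_univ, true_and,
      Set.mem_ofPred_eq] at hv hv'
    exact Prod.ext h (by rw [← hv.2, ← hv'.2, h])

/-- The number of inconsistent pairs of planes is bounded by the distance of the plane words to the
restrictions of a given word. -/
theorem sum_card_inconsistentWith_mul_le {C : Submodule F (Fin n → F)} {d : ℕ}
    (hd : ∀ x ∈ C, x ≠ 0 → d ≤ #{i | x i ≠ 0})
    {c : Fin m × Fin n → (Fin m → Fin n) → F} (hc : ∀ u, ∀ a ≠ u.1, LineIn C a (c u))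
    (r : (Fin m → Fin n) → F) :
    (∑ u, #(inconsistentWith c u)) * d ^ (m - 2) ≤
      2 * (m - 1) * ∑ u, #{p : Fin m → Fin n | p u.1 = u.2 ∧ r p ≠ c u p} := by
  set X : Fin m × Fin n → Fin m × Fin n → ℕ := fun u v =>
    #{p : Fin m → Fin n | p u.1 = u.2 ∧ p v.1 = v.2 ∧ r p ≠ c u p} with hX
  have hpair : ∀ u v, Inconsistent c u v → d ^ (m - 2) ≤ X u v + X v u := by
    rintro u v ⟨hne, p, hpu, hpv, hp⟩
    have hcard : #((univ.erase u.1).erase v.1 : Finset (Fin m)) = m - 2 := by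
      rw [card_erase_of_mem (mem_erase.2 ⟨hne.symm, mem_univ _⟩), card_erase_of_mem (mem_univ _),
        card_univ, Fintype.card_fin]
      omega
    have := pow_card_le_card_ne_zero hd (w := c u - c v) ((univ.erase u.1).erase v.1)
      (fun a ha => by
        simp only [mem_erase, mem_univ, and_true] at ha
        exact (hc u a ha.2).sub (hc v a ha.1)) p (by simpa [sub_eq_zero] using hp)
    rw [hcard] at this
    refine this.trans ((card_le_card fun q hq => ?_).trans (card_union_le _ _))
    simp only [mem_filter, mem_univ, true_and, mem_union, mem_erase, and_true, not_and_or, not_not,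
      Pi.sub_apply, sub_ne_zero] at hq ⊢
    have hqu := (hq.1 u.1 (Or.inr rfl)).trans hpu
    have hqv := (hq.1 v.1 (Or.inl rfl)).trans hpv
    -- Where `c u` and `c v` differ, `r` differs from at least one of them.
    by_cases h : r q = c u q
    · exact Or.inr ⟨hqv, hqu, fun h' => hq.2 (h.symm.trans h')⟩
    · exact Or.inl ⟨hqu, hqv, h⟩
  have hfilter : ∀ u, #(inconsistentWith c u) * d ^ (m - 2) ≤
      ∑ v with u.1 ≠ v.1, (X u v + X v u) := by
    intro u
    rw [← smul_eq_mul]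
    refine (card_nsmul_le_sum _ (fun v => X u v + X v u) _ fun v hv =>
      hpair u v (mem_inconsistentWith.1 hv)).trans (sum_le_sum_of_subset fun v hv => ?_)
    exact mem_filter.2 ⟨mem_univ v, (mem_inconsistentWith.1 hv).1⟩
  have hswap : ∑ u, ∑ v with u.1 ≠ v.1, X v u = ∑ u, ∑ v with u.1 ≠ v.1, X u v := by
    simp only [sum_filter]
    rw [sum_comm]
    simp only [ne_comm]
  calc (∑ u, #(inconsistentWith c u)) * d ^ (m - 2)
      ≤ ∑ u, ∑ v with u.1 ≠ v.1, (X u v + X v u) := by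
        rw [sum_mul]
        exact sum_le_sum fun u _ => hfilter u
    _ = 2 * ∑ u, ∑ v with u.1 ≠ v.1, X u v := by
        simp only [sum_add_distrib]
        rw [hswap, two_mul]
    _ ≤ 2 * ∑ u, (m - 1) * #{p : Fin m → Fin n | p u.1 = u.2 ∧ r p ≠ c u p} :=
        Nat.mul_le_mul_left _ (sum_le_sum fun u _ => sum_card_plane_inter_le c r u)
    _ = _ := by rw [← mul_sum, mul_assoc]

/-- Few planes meet all inconsistent pairs. -/
theorem exists_inconsistency_cover {C : Submodule F (Fin n → F)} {d : ℕ} (hm : 3 ≤ m)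
    (hd : ∀ x ∈ C, x ≠ 0 → d ≤ #{i | x i ≠ 0})
    {c : Fin m × Fin n → (Fin m → Fin n) → F} (hc : ∀ u, ∀ a ≠ u.1, LineIn C a (c u))
    (r : (Fin m → Fin n) → F) :
    ∃ H : Finset (Fin m × Fin n), (∀ u ∉ H, ∀ v ∉ H, ¬ Inconsistent c u v) ∧
      #H * d ^ (m - 1) ≤ 8 * ∑ u, #{p : Fin m → Fin n | p u.1 = u.2 ∧ r p ≠ c u p} := by
  refine ⟨({u | (m - 2) * d ≤ 2 * #(inconsistentWith c u)} : Finset (Fin m × Fin n)), fun u hu v hv huv => ?_, ?_⟩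
  · have := huv.le_card_add_card hd hc
    simp only [mem_filter, mem_univ, true_and, not_le] at hu hv
    omega
  · set H : Finset (Fin m × Fin n) := {u | (m - 2) * d ≤ 2 * #(inconsistentWith c u)} with hH
    set T := ∑ u, #{p : Fin m → Fin n | p u.1 = u.2 ∧ r p ≠ c u p}
    have h1 : #H * ((m - 2) * d) ≤ 2 * ∑ u, #(inconsistentWith c u) := by
      rw [← smul_eq_mul, mul_sum]
      refine (card_nsmul_le_sum H (fun u => 2 * #(inconsistentWith c u)) _ fun u hu =>
        (mem_filter.1 hu).2).trans (sum_le_sum_of_subset (subset_univ _))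
    have h2 := sum_card_inconsistentWith_mul_le hd hc r
    obtain ⟨l, rfl⟩ : ∃ l, m = l + 3 := ⟨m - 3, by omega⟩
    simp only [show l + 3 - 2 = l + 1 by omega, show l + 3 - 1 = l + 2 by omega] at h1 h2 ⊢
    refine le_of_mul_le_mul_left ?_ (Nat.succ_pos l)
    calc (l + 1) * (#H * d ^ (l + 2)) = #H * ((l + 1) * d) * d ^ (l + 1) := by ring
      _ ≤ 2 * (∑ u, #(inconsistentWith c u)) * d ^ (l + 1) := Nat.mul_le_mul_right _ h1
      _ = 2 * ((∑ u, #(inconsistentWith c u)) * d ^ (l + 1)) := by ring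
      _ ≤ 2 * (2 * (l + 2) * T) := Nat.mul_le_mul_left _ h2
      -- This is `m - 1 ≤ 2 * (m - 2)`, valid because `3 ≤ m`.
      _ ≤ 2 * (2 * (2 * (l + 1)) * T) := by gcongr; omega
      _ = (l + 1) * (8 * T) := by ring

/-! ### A tensor codeword close to `r`. -/

theorem card_plane (b : Fin m) (i : Fin n) :
    #{p : Fin m → Fin n | p b = i} = n ^ (m - 1) := by
  have : ({p : Fin m → Fin n | p b = i} : Finset (Fin m → Fin n)) =
      Fintype.piFinset (update (fun _ => univ) b ({i} : Finset (Fin n))) := by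
    ext p
    simp only [mem_filter, mem_univ, true_and, Fintype.mem_piFinset]
    refine ⟨fun h a => ?_, fun h => by simpa using h b⟩
    by_cases ha : a = b
    · subst ha
      simpa using h
    · simp [ha]
  rw [this, Fintype.card_piFinset, ← mul_prod_erase _ _ (mem_univ b), update_self,
    card_singleton, one_mul, prod_congr rfl (g := fun _ => n) fun a ha => by
      rw [update_of_ne (ne_of_mem_erase ha), card_univ, Fintype.card_fin],
    prod_const, card_erase_of_mem (mem_univ b), card_univ, Fintype.card_fin]

/-- Plane words close to the restrictions of `r` yield a tensor codeword close to `r`. -/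
theorem exists_mem_tensorPower_hammingDist_le {C : Submodule F (Fin n → F)} {d : ℕ} (hm : 3 ≤ m)
    (hd : ∀ x ∈ C, x ≠ 0 → d ≤ #{i | x i ≠ 0}) (hn : 0 < n) (hdn : d ≤ n)
    (hdm : 7 * n ^ m ≤ 8 * d ^ m)
    {c : Fin m × Fin n → (Fin m → Fin n) → F} (hc : ∀ u, ∀ a ≠ u.1, LineIn C a (c u))
    (r : (Fin m → Fin n) → F) :
    ∃ w ∈ tensorPower C m, m * hammingDist r w ≤
      2 ^ 16 * ∑ u, #{p : Fin m → Fin n | p u.1 = u.2 ∧ r p ≠ c u p} := by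
  set T := ∑ u, #{p : Fin m → Fin n | p u.1 = u.2 ∧ r p ≠ c u p} with hT
  by_cases hlarge : m * n ^ m ≤ 2 ^ 16 * T
  · refine ⟨0, Submodule.zero_mem _, le_trans (Nat.mul_le_mul_left _ ?_) hlarge⟩
    refine hammingDist_le_card_fintype.trans_eq ?_
    simp
  rw [not_le] at hlarge
  obtain ⟨H, hH, hHcard⟩ := exists_inconsistency_cover hm hd hc r
  rw [← hT] at hHcard
  have hpow : ∀ x : ℕ, x ^ m = x ^ (m - 1) * x := fun x => by
    rw [← pow_succ, Nat.sub_add_cancel (by omega)]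
  have hplanes : 7 * (#H * n ^ (m - 1)) ≤ 64 * T := by
    have : 7 * n ^ (m - 1) ≤ 8 * d ^ (m - 1) := by
      refine le_of_mul_le_mul_right ?_ hn
      calc 7 * n ^ (m - 1) * n = 7 * n ^ m := by rw [hpow]; ring
        _ ≤ 8 * d ^ m := hdm
        _ = 8 * d ^ (m - 1) * d := by rw [hpow]; ring
        _ ≤ 8 * d ^ (m - 1) * n := Nat.mul_le_mul_left _ hdn
    calc 7 * (#H * n ^ (m - 1)) = #H * (7 * n ^ (m - 1)) := by ring
      _ ≤ #H * (8 * d ^ (m - 1)) := Nat.mul_le_mul_left _ this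
      _ = 8 * (#H * d ^ (m - 1)) := by ring
      _ ≤ 8 * (8 * T) := Nat.mul_le_mul_left _ hHcard
      _ = 64 * T := by ring
  have hsumH : ∑ b, #{i | (b, i) ∈ H} = #H := by
    rw [← card_filter_prod (fun u => u ∈ H), filter_univ_mem]
  set K : Finset (Fin m) := {b | d ≤ #{i | (b, i) ∈ H}} with hK
  have hKd : #K * d ≤ #H := by
    rw [← smul_eq_mul, ← hsumH]
    exact (card_nsmul_le_sum K (fun b => #{i | (b, i) ∈ H}) _ fun b hb =>
      (mem_filter.1 hb).2).trans (sum_le_sum_of_subset (subset_univ _))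
  -- `7168 = 7 * 1024` and `1024 * 64 = 2 ^ 16`. Only `2 ≤ #Kᶜ` and `m ≤ 2 * #Kᶜ` are needed below.
  have hKm : 7168 * #K < m := by
    have h1 : 7 * #K * n ^ m ≤ 64 * T :=
      calc 7 * #K * n ^ m = #K * (7 * n ^ m) := by ring
        _ ≤ #K * (8 * d ^ m) := Nat.mul_le_mul_left _ hdm
        _ = 8 * (#K * d * d ^ (m - 1)) := by rw [hpow]; ring
        _ ≤ 8 * (#H * d ^ (m - 1)) := Nat.mul_le_mul_left _ (Nat.mul_le_mul_right _ hKd)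
        _ ≤ 8 * (8 * T) := Nat.mul_le_mul_left _ hHcard
        _ = 64 * T := by ring
    refine Nat.lt_of_mul_lt_mul_right (a := n ^ m) ?_
    calc 7168 * #K * n ^ m = 1024 * (7 * #K * n ^ m) := by ring
      _ ≤ 1024 * (64 * T) := Nat.mul_le_mul_left _ h1
      _ = 2 ^ 16 * T := by ring
      _ < m * n ^ m := hlarge
  have hB : #Kᶜ = m - #K := by rw [card_compl, Fintype.card_fin]
  obtain ⟨w, hw, hwc⟩ := exists_mem_tensorPower_eq_on_planes hd hc H hH Kᶜ (by omega)
    fun b hb => by simpa [hK] using hb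
  refine ⟨w, hw, ?_⟩
  -- Slice along `b`: off `H`, `w` equals the plane word; a plane in `H` is counted in full.
  have hdir : ∀ b ∈ Kᶜ, hammingDist r w ≤
      ∑ i, #{p : Fin m → Fin n | p b = i ∧ r p ≠ c (b, i) p} +
        #{i | (b, i) ∈ H} * n ^ (m - 1) := by
    intro b hb
    have hsplit : hammingDist r w = ∑ i, #{p : Fin m → Fin n | r p ≠ w p ∧ p b = i} := by
      rw [hammingDist, card_eq_sum_card_fiberwise (f := fun p : Fin m → Fin n => p b) (t := univ)
        (fun _ _ => mem_univ _)]
      simp only [filter_filter]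
    rw [hsplit, card_filter, sum_mul, ← sum_add_distrib]
    refine sum_le_sum fun i _ => ?_
    by_cases hi : (b, i) ∈ H
    · rw [if_pos hi, one_mul, ← card_plane b i]
      refine le_add_left (card_le_card fun p hp => ?_)
      exact mem_filter.2 ⟨mem_univ p, (mem_filter.1 hp).2.2⟩
    · refine le_add_right (card_le_card fun p hp => ?_)
      simp only [mem_filter, mem_univ, true_and] at hp ⊢
      obtain ⟨hp, rfl⟩ := hp
      rw [← hwc b hb p hi]
      exact ⟨rfl, hp⟩
  have htotal : #Kᶜ * hammingDist r w ≤ T + #H * n ^ (m - 1) := by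
    rw [← smul_eq_mul]
    refine (sum_const (hammingDist r w)).symm.trans_le ((sum_le_sum hdir).trans
      ((sum_le_sum_of_subset (subset_univ _)).trans_eq ?_))
    rw [sum_add_distrib, ← sum_mul, hsumH, hT, Fintype.sum_prod_type]
  have hhalf : m * hammingDist r w ≤ 2 * (#Kᶜ * hammingDist r w) := by
    rw [← mul_assoc]
    exact Nat.mul_le_mul_right _ (by omega)
  -- The constant obtained is `2 * (1 + 64 / 7)`, well below `2 ^ 16`.
  omega

/-! ### Passage to relative distances and expected robustness. -/

theorem relDistTo_exists_eq {α ι : Type*} [DecidableEq α] [Fintype ι] [Finite α] {D : Set (ι → α)}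
    (hD : D.Nonempty) (r : ι → α) : ∃ x ∈ D, relDistTo D r = relDist r x := by
  obtain ⟨x, hx, h⟩ := (hD.image (relDist r)).csInf_mem (Set.toFinite _)
  exact ⟨x, hx, h.symm⟩

theorem relDistTo_le {α ι : Type*} [DecidableEq α] [Fintype ι] {D : Set (ι → α)} {x : ι → α} (hx : x ∈ D)
    (r : ι → α) : relDistTo D r ≤ relDist r x :=
  csInf_le ⟨0, by rintro _ ⟨y, -, rfl⟩; unfold relDist; positivity⟩ ⟨x, hx, rfl⟩

theorem IsLinearCode.le_card_ne_zero {C : Submodule F (Fin n → F)} {k d : ℕ}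
    (hC : IsLinearCode C k d) (x : Fin n → F) (hx : x ∈ C) (hx0 : x ≠ 0) :
    d ≤ #{i | x i ≠ 0} := by
  refine hC.isLeast_dist.2 ⟨x, hx, 0, C.zero_mem, hx0, ?_⟩
  simp [hammingDist]

theorem IsLinearCode.dist_le_length {C : Submodule F (Fin n → F)} {k d : ℕ}
    (hC : IsLinearCode C k d) : d ≤ n := by
  obtain ⟨x, -, y, -, -, h⟩ := hC.isLeast_dist.1
  rw [← h]
  exact hammingDist_le_card_fintype.trans_eq (Fintype.card_fin n)

theorem hammingDist_insertNth {α : Type*} [DecidableEq α]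
    (r : (Fin (m + 1) → Fin n) → α) (x : (Fin m → Fin n) → α)
    (b : Fin (m + 1)) (i : Fin n) :
    hammingDist (fun p => r (Fin.insertNth (α := fun _ => Fin n) b i p)) x =
      #{p : Fin (m + 1) → Fin n | p b = i ∧ r p ≠ x (b.removeNth p)} := by
  rw [hammingDist]
  refine card_bij' (fun p _ => Fin.insertNth (α := fun _ => Fin n) b i p)
    (fun p _ => b.removeNth p) ?_ ?_ ?_ ?_
  · intro p hp
    simpa using hp
  · intro p hp
    simp only [mem_filter, mem_univ, true_and] at hp ⊢
    obtain ⟨rfl, hp⟩ := hp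
    simpa using hp
  · intro p _
    simp
  · intro p hp
    obtain rfl := (mem_filter.1 hp).2.1
    simp

end ProductCode

open ProductCode in
theorem mainTheorem1 {F : Type*} [Field F] [Finite F] [DecidableEq F]
    (m : ℕ) (hm : 3 ≤ m) (n k d : ℕ) (C : Submodule F (Fin n → F))
    (hC : ProductCode.IsLinearCode C k d)
    (hd : (7 / 8 : ℝ) ≤ (((d : ℝ) - 1) / (n : ℝ)) ^ m) :
    (ProductCode.productTester C m).IsRobust ((2 : ℝ) ^ (-16 : ℤ))
      (ProductCode.tensorPower C m : Set ((Fin m → Fin n) → F)) := by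
  have hn : 0 < n := by
    rcases Nat.eq_zero_or_pos n with rfl | hn
    · rw [Nat.cast_zero, div_zero, zero_pow (by omega)] at hd
      norm_num at hd
    · exact hn
  have hdpos : 0 < d := by
    obtain ⟨x, -, y, -, hxy, h⟩ := hC.isLeast_dist.1
    exact h ▸ hammingDist_pos.2 hxy
  have hdm : 7 * n ^ m ≤ 8 * d ^ m := by
    have h1 : (7 / 8 : ℝ) ≤ ((d : ℝ) / n) ^ m := by
      refine hd.trans (pow_le_pow_left₀ (div_nonneg ?_ n.cast_nonneg) ?_ m)
      · rw [sub_nonneg]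
        exact_mod_cast hdpos
      · gcongr
        linarith
    rw [div_pow, div_le_div_iff₀ (by norm_num) (by positivity)] at h1
    exact_mod_cast h1.trans_eq (mul_comm _ _)
  obtain ⟨m, rfl⟩ : ∃ l, m = l + 1 := ⟨m - 1, by omega⟩
  refine ⟨fun r hr s => insertNth_mem_tensorPower hr s.1 s.2, fun r => ?_⟩
  have hnear : ∀ s : Fin (m + 1) × Fin n, ∃ x ∈ tensorPower C m,
      (productTester C (m + 1)).robustness r s =
        relDist (fun p => r (Fin.insertNth (α := fun _ => Fin n) s.1 s.2 p)) x := fun s =>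
    relDistTo_exists_eq (D := (tensorPower C m : Set ((Fin m → Fin n) → F)))
      ⟨0, Submodule.zero_mem _⟩ _
  choose x hx hxr using hnear
  -- Each nearest word is extended constantly along the normal of its plane, so all plane words live
  -- on `[n] ^ m`.
  obtain ⟨w, hw, hwr⟩ := exists_mem_tensorPower_hammingDist_le hm hC.le_card_ne_zero hn
    hC.dist_le_length hdm (c := fun u p => x u (u.1.removeNth p))
    (fun u a ha => lineIn_comp_removeNth (hx u) ha) r
  have hrob : (productTester C (m + 1)).expectedRobustness r =
      ((∑ u : Fin (m + 1) × Fin n, Finset.card {p : Fin (m + 1) → Fin n |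
        p u.1 = u.2 ∧ r p ≠ x u (u.1.removeNth p)} : ℕ) : ℝ) / ((m + 1) * n ^ (m + 1)) := by
    simp only [Tester.expectedRobustness, hxr, relDist, hammingDist_insertNth]
    rw [← Finset.sum_div, div_div, Nat.cast_sum]
    congr 1
    simp
    ring
  refine (mul_le_mul_of_nonneg_left (relDistTo_le hw r) (by positivity)).trans ?_
  rw [hrob, relDist, le_div_iff₀ (by positivity)]
  have hnR : (n : ℝ) ≠ 0 := by positivity
  have hwr' : ((m : ℝ) + 1) * hammingDist r w ≤ 2 ^ 16 *
      ((∑ u : Fin (m + 1) × Fin n, Finset.card {p : Fin (m + 1) → Fin n |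
        p u.1 = u.2 ∧ r p ≠ x u (u.1.removeNth p)} : ℕ) : ℝ) := by
    exact_mod_cast hwr
  rw [Fintype.card_fun, Fintype.card_fin, Fintype.card_fin, Nat.cast_pow]
  calc (2 : ℝ) ^ (-16 : ℤ) * (hammingDist r w / (n : ℝ) ^ (m + 1)) * ((m + 1) * n ^ (m + 1))
      = (2 : ℝ) ^ (-16 : ℤ) * ((m + 1) * hammingDist r w) := by
        field_simp
    _ ≤ (2 : ℝ) ^ (-16 : ℤ) * (2 ^ 16 * _) := by gcongr
    _ = _ := by
        rw [← mul_assoc, ← zpow_natCast (2 : ℝ) 16, ← zpow_add₀ two_ne_zero]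
        norm_num
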